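/- \textbf{Setting.} Let $\mathcal X$ be a finite state space. A \emph{stochastic process} $P_{\mathcal X}$ is a coherent conditional probability (de Finetti) specifying $P_{\mathcal X}(A\mid X_u=x_u)$ for all finite $u\subset\mathbb R_{\ge0}$ (possibly empty), all $x_u\in\mathcal X_u:=\mathcal X^u$, and all $A$ in the algebra generated by the events $X_t=x$ with $t\in u$ or $t\ge\max u$. For a non-empty bounded convex set $\mathcal Q$ of rate matrices with separately specified rows and a non-empty set $\mathcal M$ of probability mass functions on $\mathcal X$, let $\mathbb P_{\mathcal Q,\mathcal M}$ be the set of all such processes that are well-behaved (for all $t$ and all histories $X_u=x_u$ with $u<t$, the difference quotients $\frac1\Delta(T_{t,x_u}^{t+\Delta}-I)$ and, if $t>0$, $\frac1\Delta(T_{t-\Delta,x_u}^{t}-I)$ stay bounded as $\Delta\to0^+$, where $T_{t,x_u}^s(x,y)=P_{\mathcal X}(X_s=y\mid X_t=x,X_u=x_u)$), for which all limit points of these quotients lie in $\mathcal Q$, and for which $P_{\mathcal X}(X_0)\in\mathcal M$. Let $\underline{\mathbb E}_{\mathcal Q,\mathcal M}$ and $\overline{\mathbb E}_{\mathcal Q,\mathcal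 M}$ be the infimum and supremum of the expectations $\mathbb E_{P_{\mathcal X}}$ over $\mathbb P_{\mathcal Q,\mathcal M}$. An \emph{output model} $(\mathcal Y,\Sigma,P_{\mathcal Y|\mathcal X})$ consists of a set $\mathcal Y$, an algebra $\Sigma$ on it and, for each $x\in\mathcal X$, a finitely additive probability $P_{\mathcal Y|\mathcal X}(\cdot\mid x)$ on $\Sigma$. For $O_u=\prod_{t\in u}O_t$ with $O_t\in\Sigma$ put $P_{\mathcal Y|\mathcal X}(O_u\mid x_u)=\prod_{t\in u}P_{\mathcal Y|\mathcal X}(O_t\mid x_t)$. The \emph{imprecise continuous-time hidden Markov chain (ICTHMC)} $\mathcal Z$ is the set of all augmented processes $P=P_{\mathcal Y|\mathcal X}\otimes P_{\mathcal X}$, $P_{\mathcal X}\in\mathbb P_{\mathcal Q,\mathcal M}$, where $P(Y_u\in O_u,X_u=x_u,X_w=x_w)=P_{\mathcal Y|\mathcal X}(O_u\mid x_u)P_{\mathcal X}(X_u=x_u,X_w=x_w)$. When $P(Y_u\in O_u)>0$, $\mathbb E_P[f(X_v)\mid Y_u\in O_u]$ is given by Bayes' rule, and otherwise it is undefined. For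 events $O_u^1\supseteq O_u^2\supseteq\cdots$ of the above product form with $\bigcap_iO_u^i=\{y_u\}$ (``shrinking to $y_u$''), put $\mathbb E_P[f(X_v)\mid Y_u=y_u]:=\lim_i\mathbb E_P[f(X_v)\mid Y_u\in O_u^i]$, which \emph{exists} if all terms are defined and the limit exists. For $\lambda_i>0$ put $\phi_u(y_u\mid x_u):=\lim_iP_{\mathcal Y|\mathcal X}(O_u^i\mid x_u)/\lambda_i$. Define $$\underline{\mathbb E}^{\mathrm L}_{\mathcal Z}[f(X_v)\mid Y_u=y_u]:=\inf\{\mathbb E_P[f(X_v)\mid Y_u=y_u]:P\in\mathcal Z,\ \mathbb E_P[f(X_v)\mid Y_u=y_u]\text{ exists}\}.$$ \textbf{Claim.} (a) There exist an ICTHMC $\mathcal Z$, non-empty finite sequences of time points $u,v$, a function $f:\mathcal X_v\to\mathbb R$, a point $y_u\in\mathcal Y^u$, events $\{O_u^i\}$ shrinking to $y_u$, and $\lambda_i>0$ such that $\phi_u(y_u\mid x_u)$ exists in $\mathbb R$ for every $x_u$, $\overline{\mathbb E}_{\mathcal Q,\mathcal M}[\phi_u(y_u\mid X_u)]>0$,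 the set $\{P\in\mathcal Z:\mathbb E_P[f(X_v)\mid Y_u=y_u]\text{ exists}\}$ is non-empty, the maximum below exists, and $$\underline{\mathbb E}^{\mathrm L}_{\mathcal Z}[f(X_v)\mid Y_u=y_u]\ne\max\{\mu\in\mathbb R:\underline{\mathbb E}_{\mathcal Q,\mathcal M}[\phi_u(y_u\mid X_u)(f(X_v)-\mu)]\ge0\}.$$ (b) More precisely, let $\mathcal X=\{x,\overline x\}$, let $\mathcal Y=[-1,1]$ with its Borel $\sigma$-algebra, let $P_{\mathcal Y|\mathcal X}(\cdot\mid x)$ be uniform on $[-1,1]$, and let $P_{\mathcal Y|\mathcal X}(\cdot\mid\overline x)$ have density $|y|$. Let $u=v=\{0\}$, $y_0=0$, $f(x)=1$, $f(\overline x)=-1$, let $\mathcal M$ be the set of all probability mass functions on $\mathcal X$, and let $\mathcal Q$ be any non-empty bounded convex set of rate matrices with separately specified rows. Let $O_0^i=(-\delta_i,\delta_i)\cap[-1,1]$ with $\delta_i>0$ non-increasing and $\delta_i\to0$, and let $\lambda_i$ be the Lebesgue measure of $O_0^i$. Then the $O_0^i$ are in $\Sigma$ and shrink to $y_0$, $\phi_0(y_0\mid\cdot)$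 exists and is real-valued, $\overline{\mathbb E}_{\mathcal Q,\mathcal M}[\phi_0(y_0\mid X_0)]>0$, $\mathbb E_P[f(X_0)\mid Y_0=y_0]$ exists for some $P\in\mathcal Z$, $\underline{\mathbb E}^{\mathrm L}_{\mathcal Z}[f(X_0)\mid Y_0=y_0]=-1$, and the maximum prescribed by the generalised Bayes' rule exists and equals $1$. -/

import Mathlib

open Set Filter Topology MeasureTheory
open scoped NNReal

/-! ## Continuous-time stochastic processes

Time points are elements of `ℝ≥0`; a finite ordered sequence of time points is a `Finset ℝ≥0`. -/

/-- A path: an assignment of a state to every time point. -/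
abbrev StatePath (X : Type*) := ℝ≥0 → X

/-- The event `X_u = x_u`. For `u = ∅` it is the sure event. -/
def stateEvent {X : Type*} (u : Finset ℝ≥0) (x : ↥u → X) : Set (StatePath X) :=
  {ω | ∀ t : ↥u, ω t = x t}

/-- The algebra of events generated by the events `X_t = x` for the time points `t` that either lie
in `u` or do not precede any element of `u` (all time points if `u` is empty). -/
def eventAlgebra (X : Type*) (u : Finset ℝ≥0) : Set (Set (StatePath X)) :=
  generateSetAlgebra {A | ∃ (t : ℝ≥0) (x : X), (t ∈ u ∨ ∀ s ∈ u, s ≤ t) ∧ A = {ω | ω t = x}}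

/-- The pairs `(A, C)` for which a process specifies `P(A | C)`: the conditioning event is
`C = (X_u = x_u)`, with `u` possibly empty, and `A` is an event about `u` and what comes after. -/
def processDomain (X : Type*) : Set (Set (StatePath X) × Set (StatePath X)) :=
  {p | ∃ (u : Finset ℝ≥0) (x : ↥u → X), p.1 ∈ eventAlgebra X u ∧ p.2 = stateEvent u x}

/-- `P(A | C)`, `(A, C) ∈ D`, is a coherent conditional probability on `D` in the sense of
de Finetti (equivalently: it extends to a full conditional probability). -/
def IsCoherentOn {Ω : Type*} (D : Set (Set Ω × Set Ω)) (P : Set Ω → Set Ω → ℝ) : Prop :=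
  ∀ (n : ℕ) (A C : Fin n → Set Ω) (c : Fin n → ℝ), 0 < n → (∀ i, (A i, C i) ∈ D) →
    ∃ ω ∈ ⋃ i, C i,
      0 ≤ ∑ i, c i * (C i).indicator (fun _ => (1 : ℝ)) ω *
        (P (A i) (C i) - (A i).indicator (fun _ => (1 : ℝ)) ω)

/-- A continuous-time stochastic process with state space `X`: a coherent conditional probability
on `processDomain X`. (Values of `cond` outside `processDomain X` carry no meaning and are never
used.) -/
structure StochasticProcess (X : Type*) where
  cond : Set (StatePath X) → Set (StatePath X) → ℝ
  coherent : IsCoherentOn (processDomain X) cond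

namespace StochasticProcess

variable {X : Type*} (P : StochasticProcess X)

/-- The (unconditional) probability `P(X_w = z)`. -/
def prob (w : Finset ℝ≥0) (z : ↥w → X) : ℝ :=
  P.cond (stateEvent w z) Set.univ

/-- The expectation `E_P[g(X_w)]`. -/
noncomputable def expect [Fintype X] (w : Finset ℝ≥0) (g : (↥w → X) → ℝ) : ℝ :=
  ∑ z : ↥w → X, g z * P.prob w z

/-- The initial probability mass function `P(X_0)`. -/
def initial : X → ℝ :=
  fun x => P.cond {ω | ω 0 = x} Set.univ

/-- The history dependent transition matrix, with entries
`P(X_s = y | X_t = x, X_u = x_u)`, where `u < t ≤ s`. -/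
def trans (u : Finset ℝ≥0) (xu : ↥u → X) (t s : ℝ≥0) : Matrix X X ℝ :=
  Matrix.of fun x y => P.cond {ω | ω s = y} ({ω | ω t = x} ∩ stateEvent u xu)

/-- The difference quotient of the transition matrix to the right of `t`. -/
noncomputable def rightQuotient [DecidableEq X]
    (u : Finset ℝ≥0) (xu : ↥u → X) (t Δ : ℝ≥0) : Matrix X X ℝ :=
  (Δ : ℝ)⁻¹ • (P.trans u xu t (t + Δ) - 1)

/-- The difference quotient of the transition matrix to the left of `t`. -/
noncomputable def leftQuotient [DecidableEq X]
    (u : Finset ℝ≥0) (xu : ↥u → X) (t Δ : ℝ≥0) : Matrix X X ℝ :=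
  (Δ : ℝ)⁻¹ • (P.trans u xu (t - Δ) t - 1)

/-- The process is well-behaved: for every time `t` and every history `X_u = x_u` with `u < t`, the
difference quotients of the transition matrices at `t` remain bounded as `Δ → 0+`. -/
def WellBehaved [DecidableEq X] : Prop :=
  ∀ (t : ℝ≥0) (u : Finset ℝ≥0) (xu : ↥u → X), (∀ s ∈ u, s < t) → ∀ x y : X,
    (∃ c : ℝ, ∀ᶠ Δ in 𝓝[>] (0 : ℝ≥0), |P.rightQuotient u xu t Δ x y| ≤ c) ∧
    (0 < t → ∃ c : ℝ, ∀ᶠ Δ in 𝓝[>] (0 : ℝ≥0), |P.leftQuotient u xu t Δ x y| ≤ c)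

/-- The outer partial derivative at time `t` given the history `X_u = x_u`: all matrices that are
the limit of right or (if `t > 0`) left difference quotients along some sequence `Δ_i → 0+`. -/
def outerDerivative [DecidableEq X] (t : ℝ≥0) (u : Finset ℝ≥0) (xu : ↥u → X) :
    Set (Matrix X X ℝ) :=
  {Q | ∃ Δ : ℕ → ℝ≥0, (∀ i, 0 < Δ i) ∧ Tendsto Δ atTop (𝓝 0) ∧
    (Tendsto (fun i => P.rightQuotient u xu t (Δ i)) atTop (𝓝 Q) ∨
      (0 < t ∧ Tendsto (fun i => P.leftQuotient u xu t (Δ i)) atTop (𝓝 Q)))}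

end StochasticProcess

/-! ## Imprecise continuous-time Markov chains -/

/-- Rate matrix: non-negative off-diagonal elements and rows that sum to zero. -/
def IsRateMatrix {X : Type*} [Fintype X] (Q : Matrix X X ℝ) : Prop :=
  (∀ x y, x ≠ y → 0 ≤ Q x y) ∧ ∀ x, ∑ y, Q x y = 0

/-- The standing assumptions on the parameter `𝒬`: a non-empty, bounded, convex set of rate
matrices with separately specified rows. -/
structure IsRateSet {X : Type*} [Fintype X] (𝒬 : Set (Matrix X X ℝ)) : Prop where
  isRateMatrix : ∀ Q ∈ 𝒬, IsRateMatrix Q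
  nonempty : 𝒬.Nonempty
  bounded : ∃ c : ℝ, ∀ Q ∈ 𝒬, ∀ x, |Q x x| < c
  convex : Convex ℝ 𝒬
  separate_rows : ∀ R : X → Matrix X X ℝ, (∀ x, R x ∈ 𝒬) → Matrix.of (fun x y => R x x y) ∈ 𝒬

/-- The ICTMC with parameters `𝒬` and `𝓜`: all well-behaved processes whose dynamics are described
by elements of `𝒬`, at all times and for all histories, and whose initial distribution is in `𝓜`. -/
def ictmc {X : Type*} [DecidableEq X] (𝒬 : Set (Matrix X X ℝ)) (𝓜 : Set (X → ℝ)) :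
    Set (StochasticProcess X) :=
  {P | P.WellBehaved ∧ P.initial ∈ 𝓜 ∧
    ∀ (t : ℝ≥0) (u : Finset ℝ≥0) (xu : ↥u → X), (∀ s ∈ u, s < t) → P.outerDerivative t u xu ⊆ 𝒬}

/-- The lower expectation of `g(X_w)` with respect to the ICTMC. -/
noncomputable def lowerExp {X : Type*} [Fintype X] [DecidableEq X]
    (𝒬 : Set (Matrix X X ℝ)) (𝓜 : Set (X → ℝ)) (w : Finset ℝ≥0) (g : (↥w → X) → ℝ) : ℝ :=
  sInf ((fun P : StochasticProcess X => P.expect w g) '' ictmc 𝒬 𝓜)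

/-- The upper expectation of `g(X_w)` with respect to the ICTMC. -/
noncomputable def upperExp {X : Type*} [Fintype X] [DecidableEq X]
    (𝒬 : Set (Matrix X X ℝ)) (𝓜 : Set (X → ℝ)) (w : Finset ℝ≥0) (g : (↥w → X) → ℝ) : ℝ :=
  sSup ((fun P : StochasticProcess X => P.expect w g) '' ictmc 𝒬 𝓜)

/-! ## Output models and augmented processes -/

/-- An output model: an algebra of events on `Y` and, for every state, a finitely additive
probability measure on it. -/
structure OutputModel (X Y : Type*) where
  events : Set (Set Y)
  isSetAlgebra : IsSetAlgebra events
  prob : X → Set Y → ℝ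
  prob_nonneg : ∀ x, ∀ S ∈ events, 0 ≤ prob x S
  prob_univ : ∀ x, prob x Set.univ = 1
  prob_union : ∀ x, ∀ S ∈ events, ∀ T ∈ events, Disjoint S T →
    prob x (S ∪ T) = prob x S + prob x T

/-- The product `P(O_u | x_u) = ∏_{t ∈ u} P(O_t | x_t)`. The event `O_u` is given by its family of
factors `O_t`, `t ∈ u`. -/
noncomputable def OutputModel.joint {X Y : Type*} (out : OutputModel X Y) {u : Finset ℝ≥0}
    (O : ↥u → Set Y) (x : ↥u → X) : ℝ :=
  ∏ t : ↥u, out.prob (x t) (O t)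

/-- An augmented stochastic process: a stochastic process augmented with the outputs. -/
structure AugmentedProcess (X Y : Type*) where
  output : OutputModel X Y
  state : StochasticProcess X

/-- Restriction of a joint state on `u ∪ v` to `u`. -/
def restrictLeft {X : Type*} {u v : Finset ℝ≥0} (z : ↥(u ∪ v) → X) : ↥u → X :=
  fun t => z ⟨t, Finset.mem_union_left v t.2⟩

/-- Restriction of a joint state on `u ∪ v` to `v`. -/
def restrictRight {X : Type*} {u v : Finset ℝ≥0} (z : ↥(u ∪ v) → X) : ↥v → X :=
  fun t => z ⟨t, Finset.mem_union_right u t.2⟩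

namespace AugmentedProcess

variable {X Y : Type*} [Fintype X] [DecidableEq X] (P : AugmentedProcess X Y)

/-- `P(Y_u ∈ O_u)`, by marginalisation of
`P(Y_u ∈ O_u, X_u = x_u) = P(O_u | x_u) P(X_u = x_u)`. -/
noncomputable def outputProb (u : Finset ℝ≥0) (O : ↥u → Set Y) : ℝ :=
  ∑ x : ↥u → X, P.output.joint O x * P.state.prob u x

/-- `P(X_v = x_v, Y_u ∈ O_u)`, by marginalisation of
`P(Y_u ∈ O_u, X_{u ∪ v} = z) = P(O_u | z_u) P(X_{u ∪ v} = z)`. -/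
noncomputable def jointProb (u v : Finset ℝ≥0) (O : ↥u → Set Y) (xv : ↥v → X) : ℝ :=
  ∑ z : ↥(u ∪ v) → X,
    if restrictRight z = xv then P.output.joint O (restrictLeft z) * P.state.prob (u ∪ v) z else 0

/-- The updated expectation `E_P[f(X_v) | Y_u ∈ O_u]`, meaningful if `P(Y_u ∈ O_u) > 0`. -/
noncomputable def condExpect (u v : Finset ℝ≥0) (O : ↥u → Set Y) (f : (↥v → X) → ℝ) : ℝ :=
  ∑ xv : ↥v → X, f xv * (P.jointProb u v O xv / P.outputProb u O)

/-- The updated expectation `E_P[f(X_v) | Y_u = y_u]`, along the events `O_u^i`, exists and is equal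
to `a`: every `E_P[f(X_v) | Y_u ∈ O_u^i]` is defined and they converge to `a`. -/
def HasPointExpect (u v : Finset ℝ≥0) (O : ℕ → ↥u → Set Y) (f : (↥v → X) → ℝ) (a : ℝ) : Prop :=
  (∀ i, 0 < P.outputProb u (O i)) ∧
    Tendsto (fun i => P.condExpect u v (O i) f) atTop (𝓝 a)

end AugmentedProcess

/-- The events `O_u^i` belong to `Σ_u` and shrink to `y_u`. -/
def ShrinksTo {X Y : Type*} (out : OutputModel X Y) {u : Finset ℝ≥0} (O : ℕ → ↥u → Set Y)
    (y : ↥u → Y) : Prop :=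
  (∀ i t, O i t ∈ out.events) ∧
    (∀ i, Set.univ.pi (O (i + 1)) ⊆ Set.univ.pi (O i)) ∧
    ⋂ i, Set.univ.pi (O i) = {y}

/-- `φ_u(y_u | x_u) = φ x_u`, as the limit of `P(O_u^i | x_u) / lam i` with `lam i > 0`, for all
`x_u`. -/
def IsLimitDensity {X Y : Type*} (out : OutputModel X Y) {u : Finset ℝ≥0} (O : ℕ → ↥u → Set Y)
    (lam : ℕ → ℝ) (φ : (↥u → X) → ℝ) : Prop :=
  (∀ i, 0 < lam i) ∧
    ∀ x : ↥u → X, Tendsto (fun i => out.joint (O i) x / lam i) atTop (𝓝 (φ x))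

/-- The ICTHMC: all processes of the ICTMC, augmented with the output model. -/
def icthmc {X Y : Type*} [DecidableEq X] (𝒬 : Set (Matrix X X ℝ)) (𝓜 : Set (X → ℝ))
    (out : OutputModel X Y) : Set (AugmentedProcess X Y) :=
  (fun P : StochasticProcess X => ⟨out, P⟩) '' ictmc 𝒬 𝓜

/-- The processes `P ∈ Z` for which `E_P[f(X_v) | Y_u = y_u]` exists. -/
def updatable {X Y : Type*} [Fintype X] [DecidableEq X] (Z : Set (AugmentedProcess X Y))
    (u v : Finset ℝ≥0) (O : ℕ → ↥u → Set Y) (f : (↥v → X) → ℝ) : Set (AugmentedProcess X Y) :=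
  {P ∈ Z | ∃ a : ℝ, P.HasPointExpect u v O f a}

/-- The limit-based updated lower expectation: the infimum of `E_P[f(X_v) | Y_u = y_u]` over all
`P ∈ Z` for which it exists. -/
noncomputable def limitLowerExp {X Y : Type*} [Fintype X] [DecidableEq X]
    (Z : Set (AugmentedProcess X Y)) (u v : Finset ℝ≥0) (O : ℕ → ↥u → Set Y)
    (f : (↥v → X) → ℝ) : ℝ :=
  sInf {a : ℝ | ∃ P ∈ Z, P.HasPointExpect u v O f a}

/-- The set `{μ : lower expectation of φ_u(X_u) (f(X_v) - μ) is non-negative}`, whose maximum is the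
value prescribed by the generalised Bayes' rule. -/
def bayesRuleSet {X : Type*} [Fintype X] [DecidableEq X] (𝒬 : Set (Matrix X X ℝ)) (𝓜 : Set (X → ℝ))
    (u v : Finset ℝ≥0) (φ : (↥u → X) → ℝ) (f : (↥v → X) → ℝ) : Set ℝ :=
  {μ | 0 ≤ lowerExp 𝒬 𝓜 (u ∪ v) (fun z => φ (restrictLeft z) * (f (restrictRight z) - μ))}

/-! ## The example: states `true`, `false`, outputs in `[-1, 1]` -/

/-- Lebesgue measure on `[-1, 1]`. -/
noncomputable def lebesgueIcc : Measure (Icc (-1 : ℝ) 1) :=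
  Measure.comap Subtype.val volume

instance : IsFiniteMeasure lebesgueIcc where
  measure_univ_lt_top := by
    unfold lebesgueIcc
    rw [(MeasurableEmbedding.subtype_coe measurableSet_Icc).comap_apply,
      Set.image_univ, Subtype.range_coe, Real.volume_Icc]
    exact ENNReal.ofReal_lt_top

/-- The output densities on `[-1, 1]`: uniform given `true`, and `|y|` given `false`. -/
noncomputable def exampleDensity (x : Bool) (y : Icc (-1 : ℝ) 1) : ℝ :=
  if x then 1 / 2 else |(y : ℝ)|

theorem exampleDensity_nonneg (x : Bool) (y : Icc (-1 : ℝ) 1) : 0 ≤ exampleDensity x y := by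
  unfold exampleDensity; split <;> positivity

theorem exampleDensity_integrable (x : Bool) : Integrable (exampleDensity x) lebesgueIcc := by
  have hc : Continuous (exampleDensity x) := by
    unfold exampleDensity; cases x <;> simp <;> fun_prop
  refine Integrable.of_bound hc.aestronglyMeasurable 1 (Eventually.of_forall fun y => ?_)
  rw [Real.norm_of_nonneg (exampleDensity_nonneg x y)]
  unfold exampleDensity
  split
  · norm_num
  · exact abs_le.mpr y.2

theorem integral_exampleDensity (x : Bool) : ∫ y, exampleDensity x y ∂lebesgueIcc = 1 := by
  cases x
  · have h : ∫ y : Icc (-1 : ℝ) 1, |(y : ℝ)| ∂lebesgueIcc = ∫ y in Icc (-1 : ℝ) 1, |y| :=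
      integral_subtype_comap measurableSet_Icc (fun y : ℝ => |y|)
    have h1 : ∫ y in (-1 : ℝ)..0, |y| = 1 / 2 := by
      rw [intervalIntegral.integral_congr (g := fun y => -y)]
      · rw [intervalIntegral.integral_neg, integral_id]; norm_num
      · intro y hy
        rw [uIcc_of_le (by norm_num)] at hy
        exact abs_of_nonpos hy.2
    have h2 : ∫ y in (0 : ℝ)..1, |y| = 1 / 2 := by
      rw [intervalIntegral.integral_congr (g := fun y => y)]
      · simp [integral_id]
      · intro y hy
        rw [uIcc_of_le (by norm_num)] at hy
        exact abs_of_nonneg hy.1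
    have h3 : ∫ y in (-1 : ℝ)..1, |y| = 1 := by
      rw [← intervalIntegral.integral_add_adjacent_intervals (b := 0)
        (continuous_abs.intervalIntegrable _ _) (continuous_abs.intervalIntegrable _ _), h1, h2]
      norm_num
    simp only [exampleDensity, Bool.false_eq_true, if_false]
    rw [h, integral_Icc_eq_integral_Ioc, ← intervalIntegral.integral_of_le (by norm_num), h3]
  · have h : ∫ _ : Icc (-1 : ℝ) 1, (1 / 2 : ℝ) ∂lebesgueIcc = ∫ _ in Icc (-1 : ℝ) 1, (1 / 2 : ℝ) :=
      integral_subtype_comap measurableSet_Icc (fun _ : ℝ => (1 / 2 : ℝ))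
    simp only [exampleDensity, if_true]
    rw [h]
    simp
    norm_num

/-- The output model of the example, on the Borel sets of `[-1, 1]`. -/
noncomputable def exampleOutput : OutputModel Bool (Icc (-1 : ℝ) 1) where
  events := {S | MeasurableSet S}
  isSetAlgebra :=
    { empty_mem := by simp
      compl_mem := fun _ hS => by simpa using hS
      union_mem := fun S T hS hT => by
        have hS' : MeasurableSet S := by simpa using hS
        have hT' : MeasurableSet T := by simpa using hT
        simpa using hS'.union hT' }
  prob x S := ∫ y in S, exampleDensity x y ∂lebesgueIcc
  prob_nonneg x S _ := integral_nonneg (exampleDensity_nonneg x)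
  prob_univ x := by rw [Measure.restrict_univ, integral_exampleDensity]
  prob_union x S _ T hT hST :=
    setIntegral_union hST (by simpa using hT) (exampleDensity_integrable x).integrableOn
      (exampleDensity_integrable x).integrableOn

/-- The single time point sequence `0`. -/
def exampleTime : Finset ℝ≥0 := {0}

/-- The function `f(X_0)`, with value `1` in the state `true` and `-1` in the state `false`. -/
def exampleFun (x : ↥exampleTime → Bool) : ℝ :=
  if x ⟨0, Finset.mem_singleton_self 0⟩ then 1 else -1

/-- The open interval `(-d, d)` in `[-1, 1]`. -/
def exampleInterval (d : ℝ) : Set (Icc (-1 : ℝ) 1) :=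
  {y | |(y : ℝ)| < d}

/-- The point `y_0 = 0`. -/
def examplePoint : ↥exampleTime → Icc (-1 : ℝ) 1 :=
  fun _ => ⟨0, by norm_num, by norm_num⟩

/-! ## Finite-dimensional distributions of a Markov chain -/

/-! The density `|y|` vanishes at the observed point 0, so the limit density `exampleLimit` is zero
in the state `false`, and the generalised Bayes' rule only sees the state `true`: the expectation of
`φ (f - μ)` is `(1 - μ) / 2 * P.initial true`, whose infimum over all initial distributions is
non-negative exactly for `μ ≤ 1`. The limit-based update also counts the processes that start in
`false` with probability one. Each interval around 0 still has positive probability under them,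
because `|y| > 0` almost everywhere, so they are updated along the whole sequence and give the
constant value `-1`. The two sides are computed in `isGreatest_bayesRuleSet_example` and
`limitLowerExp_example`.

Most of the work goes into `exists_mem_ictmc`: point masses must really occur as initial
distributions, although a process also has to specify probabilities given histories of probability
zero. The initial distribution and the rates are therefore perturbed to be strictly positive. On
finitely many time points every history then has positive probability, ordinary conditioning is
coherent (`chainCond_coherent`), and all histories obey the same transition law
(`chainMean_markov`). Coherence involves finitely many events at a time and is a closed condition,
so it survives an ultrafilter limit in which the time set grows and the perturbation vanishes
(`exists_markov_process`). -/

/-- The expectation of `F` under the Markov chain with transition matrices `T` that is at time `t`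
in the state prescribed by `ω` and moves at the times in the list only; at all other times the path
coincides with `ω`. -/
noncomputable def chainExp {X : Type*} [Fintype X] (T : ℝ≥0 → Matrix X X ℝ) :
    List ℝ≥0 → ℝ≥0 → StatePath X → (StatePath X → ℝ) → ℝ
  | [], _, ω, F => F ω
  | s :: l, t, ω, F => ∑ y, T (s - t) (ω t) y * chainExp T l s (Function.update ω s y) F

section ChainExp

variable {X : Type*} [Fintype X] (T : ℝ≥0 → Matrix X X ℝ)

theorem chainExp_add (l : List ℝ≥0) (t : ℝ≥0) (ω : StatePath X) (F G : StatePath X → ℝ) :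
    chainExp T l t ω (fun η => F η + G η) = chainExp T l t ω F + chainExp T l t ω G := by
  induction l generalizing t ω with
  | nil => rfl
  | cons s l ih => simp only [chainExp, ih, mul_add, Finset.sum_add_distrib]

theorem chainExp_const_mul (l : List ℝ≥0) (t : ℝ≥0) (ω : StatePath X) (c : ℝ)
    (F : StatePath X → ℝ) :
    chainExp T l t ω (fun η => c * F η) = c * chainExp T l t ω F := by
  induction l generalizing t ω with
  | nil => rfl
  | cons s l ih => simp only [chainExp, ih, Finset.mul_sum, mul_left_comm c]

/-- Only paths that coincide with `ω` off the list matter. -/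
theorem chainExp_congr (l : List ℝ≥0) (t : ℝ≥0) (ω : StatePath X) (F G : StatePath X → ℝ)
    (h : ∀ η : StatePath X, (∀ r ∉ l, η r = ω r) → F η = G η) :
    chainExp T l t ω F = chainExp T l t ω G := by
  induction l generalizing t ω with
  | nil => exact h ω fun _ _ => rfl
  | cons s l ih =>
    simp only [chainExp]
    refine Finset.sum_congr rfl fun y _ => ?_
    rw [ih s _ fun η hη => h η fun r hr => ?_]
    rw [List.mem_cons, not_or] at hr
    rw [hη r hr.2, Function.update_of_ne hr.1]

theorem chainExp_const (hsum : ∀ t x, ∑ y, T t x y = 1) (l : List ℝ≥0) (t : ℝ≥0)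
    (ω : StatePath X) (c : ℝ) : chainExp T l t ω (fun _ => c) = c := by
  induction l generalizing t ω with
  | nil => rfl
  | cons s l ih => simp only [chainExp, ih, ← Finset.sum_mul, hsum, one_mul]

theorem chainExp_nonneg (hpos : ∀ t, 0 < t → ∀ x y, 0 < T t x y) (l : List ℝ≥0) (t : ℝ≥0)
    (hl : (t :: l).Pairwise (· < ·)) (ω : StatePath X) (F : StatePath X → ℝ) (hF : ∀ η, 0 ≤ F η) :
    0 ≤ chainExp T l t ω F := by
  induction l generalizing t ω with
  | nil => exact hF ω
  | cons s l ih =>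
    rw [List.pairwise_cons] at hl
    exact Finset.sum_nonneg fun y _ => mul_nonneg
      (hpos _ (tsub_pos_of_lt (hl.1 s List.mem_cons_self)) _ _).le (ih s hl.2 _)

/-- Every step has positive probability, so the chain follows the prescribed path `η` with positive
probability; among the summands, `y = η s` is the one that stays on it. -/
theorem chainExp_pos (hpos : ∀ t, 0 < t → ∀ x y, 0 < T t x y) (l : List ℝ≥0) (t : ℝ≥0)
    (hl : (t :: l).Pairwise (· < ·)) (ω η : StatePath X) (F : StatePath X → ℝ)
    (hF : ∀ η, 0 ≤ F η) (hη : ∀ r ∉ l, η r = ω r) (hFη : 0 < F η) :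
    0 < chainExp T l t ω F := by
  induction l generalizing t ω with
  | nil =>
    have : η = ω := funext fun r => hη r List.not_mem_nil
    exact this ▸ hFη
  | cons s l ih =>
    rw [List.pairwise_cons] at hl
    have hT := fun y => hpos _ (tsub_pos_of_lt (hl.1 s List.mem_cons_self)) (ω t) y
    refine Finset.sum_pos' (fun y _ => mul_nonneg (hT y).le
      (chainExp_nonneg T hpos l s hl.2 _ F hF)) ⟨η s, Finset.mem_univ _, mul_pos (hT _) ?_⟩
    refine ih s hl.2 _ fun r hr => ?_
    by_cases hrs : r = s
    · rw [hrs, Function.update_self]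
    · rw [Function.update_of_ne hrs]
      exact hη r (by simp [hrs, hr])

variable [DecidableEq X]

/-- The marginal at a later time. -/
theorem chainExp_marginal (hsum : ∀ t x, ∑ y, T t x y = 1)
    (hadd : ∀ s t, T (s + t) = T s * T t) (l : List ℝ≥0) (t : ℝ≥0)
    (hl : (t :: l).Pairwise (· < ·)) (ω : StatePath X) (s : ℝ≥0) (hs : s ∈ l) (y : X) :
    chainExp T l t ω (fun η => if η s = y then 1 else 0) = T (s - t) (ω t) y := by
  induction l generalizing t ω with
  | nil => exact absurd hs List.not_mem_nil
  | cons r l ih =>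
    rw [List.pairwise_cons] at hl
    have hrl := (List.pairwise_cons.mp hl.2).1
    simp only [chainExp]
    rcases List.mem_cons.mp hs with rfl | hs'
    -- The remaining moves are later than `s`, so the state at `s` is already final.
    · have : ∀ z, chainExp T l s (Function.update ω s z) (fun η => if η s = y then 1 else 0) =
          if z = y then 1 else 0 := fun z => by
        rw [chainExp_congr T l s _ _ (fun _ => if z = y then 1 else 0) fun η hη => ?_,
          chainExp_const T hsum]
        rw [hη s fun h => lt_irrefl _ (hrl s h), Function.update_self]
      simp [this]
    · have htr := hl.1 r List.mem_cons_self
      simp only [ih r hl.2 _ hs', Function.update_self]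
      rw [show s - t = (r - t) + (s - r) by
        rw [add_comm, tsub_add_tsub_cancel (hrl s hs').le htr.le], hadd, Matrix.mul_apply]

/-- The Markov property: given the state at time `r`, the state at time `s > r` is independent of
the history `H`. -/
theorem chainExp_markov (hsum : ∀ t x, ∑ y, T t x y = 1)
    (hadd : ∀ s t, T (s + t) = T s * T t) (l : List ℝ≥0) (t : ℝ≥0)
    (hl : (t :: l).Pairwise (· < ·)) (ω : StatePath X) (r s : ℝ≥0) (hr : r ∈ t :: l) (hs : s ∈ l)
    (hrs : r < s) (H : StatePath X → ℝ)
    (hH : ∀ η η' : StatePath X, (∀ q ≤ r, η q = η' q) → H η = H η') (x y : X)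
    (hHx : ∀ η : StatePath X, η r ≠ x → H η = 0) :
    chainExp T l t ω (fun η => (if η s = y then 1 else 0) * H η) =
      T (s - r) x y * chainExp T l t ω H := by
  induction l generalizing t ω with
  | nil => exact absurd hs List.not_mem_nil
  | cons q l ih =>
    have hl' := List.pairwise_cons.mp hl
    rcases List.mem_cons.mp hr with rfl | hr'
    -- If `r` is the present time, all further moves are later than `r`, so `H` is constant on the
    -- reachable paths.
    · have h : ∀ η : StatePath X, (∀ p ∉ q :: l, η p = ω p) → H η = H ω := fun η hη =>
        hH η ω fun p hp => hη p fun hpl => (hl'.1 p hpl).not_ge hp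
      rw [chainExp_congr T _ r ω H (fun _ => H ω) h, chainExp_const T hsum,
        chainExp_congr T _ r ω _ (fun η => H ω * if η s = y then 1 else 0) fun η hη => by
          rw [h η hη, mul_comm], chainExp_const_mul,
        chainExp_marginal T hsum hadd _ r hl ω s hs]
      by_cases hx : ω r = x
      · rw [hx, mul_comm]
      · rw [hHx ω hx, zero_mul, mul_zero]
    · have hq := (List.pairwise_cons.mp hl'.2).1
      have hs' : s ∈ l := by
        rcases List.mem_cons.mp hs with rfl | h
        · rcases List.mem_cons.mp hr' with rfl | h'
          · exact absurd hrs (lt_irrefl _)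
          · exact absurd hrs (hq r h').not_gt
        · exact h
      simp only [chainExp, ih q hl'.2 _ hr' hs', Finset.mul_sum]
      exact Finset.sum_congr rfl fun z _ => by ring

end ChainExp

/-! ## Limits of coherent conditional probabilities -/

theorem indicator_one_congr {Ω : Type*} {A : Set Ω} {a b : Ω} (h : a ∈ A ↔ b ∈ A) :
    A.indicator (fun _ => (1 : ℝ)) a = A.indicator (fun _ => (1 : ℝ)) b := by
  classical
  simp only [indicator_apply, h]

/-- Coherence is a finitary closed condition. -/
theorem isCoherentOn_of_tendsto {Ω ι : Type*} {D : Set (Set Ω × Set Ω)} {F : Filter ι} [F.NeBot]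
    {q : ι → Set Ω → Set Ω → ℝ} {P : Set Ω → Set Ω → ℝ}
    (hlim : ∀ A C, Tendsto (fun k => q k A C) F (𝓝 (P A C)))
    (hq : ∀ (n : ℕ) (A C : Fin n → Set Ω) (c : Fin n → ℝ), 0 < n → (∀ i, (A i, C i) ∈ D) →
      ∀ᶠ k in F, ∃ ω ∈ ⋃ i, C i,
        0 ≤ ∑ i, c i * (C i).indicator (fun _ => (1 : ℝ)) ω *
          (q k (A i) (C i) - (A i).indicator (fun _ => (1 : ℝ)) ω)) :
    IsCoherentOn D P := by
  classical
  intro n A C c hn hD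
  by_contra! hneg
  -- the value at `ω` depends only on which of the finitely many events contain `ω`
  have hev : ∀ b : Fin n → Prop × Prop, ∀ᶠ k in F, ∀ ω ∈ ⋃ i, C i,
      (∀ i, (ω ∈ A i, ω ∈ C i) = b i) →
      ∑ i, c i * (C i).indicator (fun _ => (1 : ℝ)) ω *
        (q k (A i) (C i) - (A i).indicator (fun _ => (1 : ℝ)) ω) < 0 := by
    intro b
    by_cases hb : ∃ ω ∈ ⋃ i, C i, ∀ i, (ω ∈ A i, ω ∈ C i) = b i
    -- One representative decides the sign for every path with the same membership pattern, and
    -- there are finitely many patterns.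
    · obtain ⟨ω, hω, hωb⟩ := hb
      have ht : Tendsto (fun k => ∑ i, c i * (C i).indicator (fun _ => (1 : ℝ)) ω *
          (q k (A i) (C i) - (A i).indicator (fun _ => (1 : ℝ)) ω)) F
          (𝓝 (∑ i, c i * (C i).indicator (fun _ => (1 : ℝ)) ω *
          (P (A i) (C i) - (A i).indicator (fun _ => (1 : ℝ)) ω))) :=
        tendsto_finsetSum _ fun i _ => ((hlim _ _).sub_const _).const_mul _
      filter_upwards [ht.eventually_lt_const (hneg ω hω)] with k hk ω' _ hωb'
      have h := fun i => Prod.ext_iff.mp ((hωb' i).trans (hωb i).symm)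
      simpa only [fun i => indicator_one_congr (eq_iff_iff.mp (h i).1),
        fun i => indicator_one_congr (eq_iff_iff.mp (h i).2)] using hk
    · exact Eventually.of_forall fun k ω hω hωb => absurd ⟨ω, hω, hωb⟩ hb
  obtain ⟨k, hk1, ω, hω, hk2⟩ := ((eventually_all.mpr hev).and (hq n A C c hn hD)).exists
  exact (hk1 (fun i => (ω ∈ A i, ω ∈ C i)) ω hω fun _ => rfl).not_ge hk2

/-! ## Existence of Markov processes -/

/-- The expectation of `F` under the Markov chain with initial distribution `p` and transition
matrices `T` that moves at the positive times in `w` only. -/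
noncomputable def chainMean {X : Type*} [Fintype X] (p : X → ℝ) (T : ℝ≥0 → Matrix X X ℝ)
    (w : Finset ℝ≥0) (F : StatePath X → ℝ) : ℝ :=
  ∑ x, p x * chainExp T ((w.erase 0).sort (· ≤ ·)) 0 (fun _ => x) F

theorem pairwise_cons_sort_erase_zero (w : Finset ℝ≥0) :
    (0 :: (w.erase 0).sort (· ≤ ·)).Pairwise (· < ·) :=
  List.pairwise_cons.mpr
    ⟨fun _ ha => pos_iff_ne_zero.mpr (Finset.ne_of_mem_erase ((Finset.mem_sort _).mp ha)),
      (w.erase 0).sortedLT_sort.pairwise⟩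

section ChainMean

variable {X : Type*} [Fintype X] (p : X → ℝ) (T : ℝ≥0 → Matrix X X ℝ) (w : Finset ℝ≥0)

theorem chainMean_add (F G : StatePath X → ℝ) :
    chainMean p T w (fun η => F η + G η) = chainMean p T w F + chainMean p T w G := by
  simp only [chainMean, chainExp_add, mul_add, Finset.sum_add_distrib]

theorem chainMean_const_mul (c : ℝ) (F : StatePath X → ℝ) :
    chainMean p T w (fun η => c * F η) = c * chainMean p T w F := by
  simp only [chainMean, chainExp_const_mul, Finset.mul_sum, mul_left_comm c]

theorem chainMean_sum {ι : Type*} (s : Finset ι) (F : ι → StatePath X → ℝ) :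
    chainMean p T w (fun η => ∑ i ∈ s, F i η) = ∑ i ∈ s, chainMean p T w (F i) := by
  classical
  induction s using Finset.induction_on with
  | empty => simpa using chainMean_const_mul p T w 0 (fun _ => 0)
  | insert i s hi ih => simp only [Finset.sum_insert hi, chainMean_add, ih]

variable {p T}

theorem chainMean_nonneg (hp : ∀ x, 0 < p x) (hpos : ∀ t, 0 < t → ∀ x y, 0 < T t x y)
    (F : StatePath X → ℝ) (hF : ∀ η, 0 ≤ F η) : 0 ≤ chainMean p T w F :=
  Finset.sum_nonneg fun x _ => mul_nonneg (hp x).le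
    (chainExp_nonneg T hpos _ _ (pairwise_cons_sort_erase_zero w) _ F hF)

/-- A nonnegative function has positive mean if it is positive on an event that depends on the
times in `w` only. -/
theorem chainMean_pos (hp : ∀ x, 0 < p x) (hpos : ∀ t, 0 < t → ∀ x y, 0 < T t x y)
    (F : StatePath X → ℝ) (hF : ∀ η, 0 ≤ F η) (ω : StatePath X)
    (hω : ∀ η : StatePath X, (∀ r ∈ w, η r = ω r) → 0 < F η) : 0 < chainMean p T w F := by
  refine Finset.sum_pos' (fun x _ => mul_nonneg (hp x).le
    (chainExp_nonneg T hpos _ _ (pairwise_cons_sort_erase_zero w) _ F hF))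
    ⟨ω 0, Finset.mem_univ _, mul_pos (hp _) ?_⟩
  -- Off `w` the target path takes the value `ω 0` of the constant starting path, since the chain
  -- cannot move there.
  refine chainExp_pos T hpos _ _ (pairwise_cons_sort_erase_zero w) _
    (fun r => if r ∈ w then ω r else ω 0) F hF (fun r hr => ?_) (hω _ fun r hr => if_pos hr)
  rw [Finset.mem_sort, Finset.mem_erase, not_and_or, not_not] at hr
  rcases hr with rfl | hr
  · exact ite_self _
  · exact if_neg hr

variable [DecidableEq X]

theorem chainMean_initial (hsum : ∀ t x, ∑ y, T t x y = 1) (x : X) :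
    chainMean p T w ({ω | ω 0 = x}.indicator fun _ => 1) = p x := by
  have : ∀ z, chainExp T ((w.erase 0).sort (· ≤ ·)) 0 (fun _ => z)
      ({ω | ω 0 = x}.indicator fun _ => 1) = if z = x then 1 else 0 := fun z => by
    rw [chainExp_congr T _ 0 _ _ (fun _ => if z = x then 1 else 0) fun η hη => ?_,
      chainExp_const T hsum]
    simp [indicator, hη 0 (by simp)]
  simp [chainMean, this]

/-- An event `C` about the past up to `r` that fixes the state at `r` only contributes a factor.
Dividing by its mean gives a transition probability that does not depend on the history. -/
theorem chainMean_markov (hsum : ∀ t x, ∑ y, T t x y = 1) (hadd : ∀ s t, T (s + t) = T s * T t)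
    {r s : ℝ≥0} (hr : r ∈ w) (hs : s ∈ w) (hrs : r < s) (C : Set (StatePath X))
    (hC : ∀ η η' : StatePath X, (∀ q ≤ r, η q = η' q) → η ∈ C → η' ∈ C) (x y : X)
    (hCx : ∀ η ∈ C, η r = x) :
    chainMean p T w (({ω | ω s = y} ∩ C).indicator fun _ => 1) =
      T (s - r) x y * chainMean p T w (C.indicator fun _ => 1) := by
  have hsplit : (({ω : StatePath X | ω s = y} ∩ C).indicator fun _ => (1 : ℝ)) =
      fun η => (if η s = y then 1 else 0) * C.indicator (fun _ => 1) η := by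
    classical
    ext η
    by_cases h : η s = y <;> by_cases h' : η ∈ C <;> simp [indicator, h, h']
  simp only [chainMean, hsplit, Finset.mul_sum]
  refine Finset.sum_congr rfl fun z _ => ?_
  rw [chainExp_markov T hsum hadd _ 0 (pairwise_cons_sort_erase_zero w) _ r s ?_ ?_ hrs _ ?_ x y
    ?_, mul_left_comm]
  · simp [hr, eq_or_ne]
  · simp [hs, (pos_of_gt hrs).ne']
  · intro η η' h
    exact indicator_one_congr ⟨hC η η' h, hC η' η fun q hq => (h q hq).symm⟩
  · exact fun η hη => indicator_of_notMem (fun h => hη (hCx η h)) _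

end ChainMean

/-! ### Coherence of conditioning in a positive chain -/

/-- The conditional probability of `A` given `C` under the chain that moves at the times in `w`. -/
noncomputable def chainCond {X : Type*} [Fintype X] (p : X → ℝ) (T : ℝ≥0 → Matrix X X ℝ)
    (w : Finset ℝ≥0) (A C : Set (StatePath X)) : ℝ :=
  chainMean p T w ((A ∩ C).indicator fun _ => 1) / chainMean p T w (C.indicator fun _ => 1)

section ChainCond

variable {X : Type*} [Fintype X] {p : X → ℝ} {T : ℝ≥0 → Matrix X X ℝ} (w : Finset ℝ≥0)
  (hp : ∀ x, 0 < p x) (hpos : ∀ t, 0 < t → ∀ x y, 0 < T t x y)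

include hp hpos

/-- Valid for all pairs of events, since a zero denominator gives the value 0. The compact range is
what provides ultrafilter limits. -/
theorem chainCond_mem_Icc (A C : Set (StatePath X)) : chainCond p T w A C ∈ Icc (0 : ℝ) 1 := by
  have h1 := fun B : Set (StatePath X) => chainMean_nonneg w hp hpos (B.indicator fun _ => 1)
    (indicator_nonneg fun _ _ => zero_le_one)
  refine ⟨div_nonneg (h1 _) (h1 _), div_le_one_of_le₀ ?_ (h1 _)⟩
  have h2 := h1 (C \ A)
  have h3 : (C.indicator fun _ => (1 : ℝ)) = fun η =>
      ((A ∩ C).indicator fun _ => 1) η + ((C \ A).indicator fun _ => 1) η := by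
    classical
    ext η
    by_cases h : η ∈ A <;> by_cases h' : η ∈ C <;> simp [indicator, h, h']
  rw [h3, chainMean_add]
  linarith

theorem chainMean_stateEvent_pos [Nonempty X] (u : Finset ℝ≥0) (hu : u ⊆ w) (x : ↥u → X) :
    0 < chainMean p T w ((stateEvent u x).indicator fun _ => 1) := by
  classical
  refine chainMean_pos w hp hpos _ (indicator_nonneg fun _ _ => zero_le_one)
    (fun r => if h : r ∈ u then x ⟨r, h⟩ else Classical.arbitrary X) fun η hη => ?_
  rw [indicator_of_mem]
  · exact one_pos
  · exact fun t => (hη t (hu t.2)).trans (dif_pos t.2)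

/-- The total gain `G` of the bets has mean zero, because each conditional probability is a fair
price. If `G` were negative throughout the union of the `C i`, then, being zero elsewhere and the
union having positive probability, it would have negative mean. -/
theorem chainCond_coherent [Nonempty X] {n : ℕ} (hn : 0 < n) (A C : Fin n → Set (StatePath X))
    (c : Fin n → ℝ) (hC : ∀ i, ∃ u ⊆ w, ∃ x : ↥u → X, C i = stateEvent u x) :
    ∃ ω ∈ ⋃ i, C i, 0 ≤ ∑ i, c i * (C i).indicator (fun _ => (1 : ℝ)) ω *
      (chainCond p T w (A i) (C i) - (A i).indicator (fun _ => (1 : ℝ)) ω) := by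
  classical
  by_contra! hneg
  set G : StatePath X → ℝ := fun ω => ∑ i, c i * (C i).indicator (fun _ => (1 : ℝ)) ω *
      (chainCond p T w (A i) (C i) - (A i).indicator (fun _ => (1 : ℝ)) ω) with hG
  have hmean : chainMean p T w G = 0 := by
    rw [hG, chainMean_sum]
    refine Finset.sum_eq_zero fun i _ => ?_
    have hi : (fun ω => c i * (C i).indicator (fun _ => (1 : ℝ)) ω *
        (chainCond p T w (A i) (C i) - (A i).indicator (fun _ => (1 : ℝ)) ω)) = fun ω =>
        c i * (chainCond p T w (A i) (C i) * (C i).indicator (fun _ => (1 : ℝ)) ω +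
          (-1) * (A i ∩ C i).indicator (fun _ => (1 : ℝ)) ω) := by
      ext ω
      by_cases h : ω ∈ A i <;> by_cases h' : ω ∈ C i <;> simp [indicator, h, h', sub_eq_add_neg]
    obtain ⟨u, hu, x, hx⟩ := hC i
    have hpC := chainMean_stateEvent_pos w hp hpos u hu x
    rw [← hx] at hpC
    rw [hi, chainMean_const_mul, chainMean_add, chainMean_const_mul, chainMean_const_mul,
      chainCond, div_mul_cancel₀ _ hpC.ne']
    ring
  have hoff : ∀ ω, ω ∉ ⋃ i, C i → G ω = 0 := fun ω hω =>
    Finset.sum_eq_zero fun i _ => by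
      rw [indicator_of_notMem fun h => hω (mem_iUnion.mpr ⟨i, h⟩), mul_zero, zero_mul]
  obtain ⟨u, hu, x, hx⟩ := hC ⟨0, hn⟩
  have hpos' : 0 < chainMean p T w fun ω => (-1) * G ω := by
    refine chainMean_pos w hp hpos _ (fun η => ?_)
      (fun r => if h : r ∈ u then x ⟨r, h⟩ else Classical.arbitrary X) fun η hη => ?_
    · by_cases h : η ∈ ⋃ i, C i
      · linarith [hneg η h]
      · rw [hoff η h, mul_zero]
    · have h : η ∈ ⋃ i, C i := mem_iUnion.mpr ⟨⟨0, hn⟩, by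
        rw [hx]; exact fun t => (hη t (hu t.2)).trans (dif_pos t.2)⟩
      linarith [hneg η h]
  rw [chainMean_const_mul, hmean, mul_zero] at hpos'
  exact lt_irrefl _ hpos'

end ChainCond

/-- A limit of positive Markov semigroups and initial distributions is realised by a stochastic
process; its transition matrices are prescribed given every history, including those of probability
zero. -/
theorem exists_markov_process {X : Type*} [Fintype X] [DecidableEq X] [Nonempty X]
    {p : ℕ → X → ℝ} {T : ℕ → ℝ≥0 → Matrix X X ℝ} {p₀ : X → ℝ} {T₀ : ℝ≥0 → Matrix X X ℝ}
    (hp : ∀ n x, 0 < p n x) (hpsum : ∀ n, ∑ x, p n x = 1)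
    (hpos : ∀ n t, 0 < t → ∀ x y, 0 < T n t x y) (hsum : ∀ n t x, ∑ y, T n t x y = 1)
    (hadd : ∀ n s t, T n (s + t) = T n s * T n t)
    (hp₀ : ∀ x, Tendsto (fun n => p n x) atTop (𝓝 (p₀ x)))
    (hT₀ : ∀ t x y, Tendsto (fun n => T n t x y) atTop (𝓝 (T₀ t x y))) :
    ∃ P : StochasticProcess X, P.initial = p₀ ∧
      ∀ (u : Finset ℝ≥0) (xu : ↥u → X) (t s : ℝ≥0), (∀ r ∈ u, r < t) → t < s →
        P.trans u xu t s = T₀ (s - t) := by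
  -- Along this ultrafilter the time set eventually contains any given finite set, and the
  -- perturbation index tends to infinity.
  let F : Ultrafilter (Finset ℝ≥0 × ℕ) := Ultrafilter.of atTop
  have hF : (F : Filter (Finset ℝ≥0 × ℕ)) ≤ atTop := Ultrafilter.of_le _
  have hF2 : Tendsto Prod.snd (F : Filter (Finset ℝ≥0 × ℕ)) atTop := by
    rw [← prod_atTop_atTop_eq] at hF
    exact tendsto_snd.mono_left hF
  have hF1 : ∀ u : Finset ℝ≥0, ∀ᶠ k in (F : Filter (Finset ℝ≥0 × ℕ)), u ⊆ k.1 := fun u =>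
    hF ((eventually_ge_atTop (u, 0)).mono fun k hk => hk.1)
  let q : Finset ℝ≥0 × ℕ → Set (StatePath X) → Set (StatePath X) → ℝ :=
    fun k => chainCond (p k.2) (T k.2) k.1
  have hex : ∀ A C, ∃ a, Tendsto (fun k => q k A C) F (𝓝 a) := fun A C => by
    obtain ⟨a, -, ha⟩ := isCompact_Icc.ultrafilter_le_nhds (F.map fun k => q k A C)
      (tendsto_principal.mpr (Eventually.of_forall fun k : Finset ℝ≥0 × ℕ =>
        chainCond_mem_Icc k.1 (hp k.2) (hpos k.2) A C))
    exact ⟨a, ha⟩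
  choose P hP using hex
  refine ⟨⟨P, isCoherentOn_of_tendsto hP fun n A C c hn hD => ?_⟩, ?_, ?_⟩
  · choose u x hu using hD
    filter_upwards [eventually_all.mpr fun i => hF1 (u i)] with k hk
    exact chainCond_coherent k.1 (hp k.2) (hpos k.2) hn A C c fun i => ⟨u i, hk i, x i, (hu i).2⟩
  · funext x
    refine tendsto_nhds_unique (hP {ω | ω 0 = x} univ) ?_
    have : ∀ k, q k {ω | ω 0 = x} univ = p k.2 x := fun k => by
      have h1 : chainMean (p k.2) (T k.2) k.1 (univ.indicator fun _ => 1) = 1 := by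
        simp [chainMean, chainExp_const _ (hsum k.2), hpsum]
      simp only [q, chainCond, h1, inter_univ, div_one, chainMean_initial _ (hsum k.2)]
    simp only [this]
    exact (hp₀ x).comp hF2
  · intro u xu t s hu hts
    ext x y
    set C := {ω : StatePath X | ω t = x} ∩ stateEvent u xu with hCdef
    refine tendsto_nhds_unique (hP {ω | ω s = y} C) ?_
    refine ((hT₀ (s - t) x y).comp hF2).congr' ?_
    classical
    filter_upwards [hF1 (insert s (insert t u))] with k hk
    -- The history has positive probability in each approximation, even if its limit probability is
    -- zero; this is what determines the limit transition matrix given null histories.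
    have hCpos : 0 < chainMean (p k.2) (T k.2) k.1 (C.indicator fun _ => 1) := by
      refine chainMean_pos k.1 (hp k.2) (hpos k.2) _ (indicator_nonneg fun _ _ => zero_le_one)
        (fun r => if h : r ∈ u then xu ⟨r, h⟩ else x) fun η hη => ?_
      rw [indicator_of_mem]
      · exact one_pos
      · refine ⟨(hη t (hk (by simp))).trans (dif_neg fun h => lt_irrefl _ (hu t h)), fun r => ?_⟩
        exact (hη r (hk (by simp))).trans (dif_pos r.2)
    simp only [Function.comp, q, chainCond]
    rw [chainMean_markov k.1 (hsum k.2) (hadd k.2) (hk (by simp)) (hk (by simp)) hts C ?_ x y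
      fun η hη => hη.1, mul_div_cancel_right₀ _ hCpos.ne']
    intro η η' h hη
    exact ⟨(h t le_rfl).symm.trans hη.1, fun r => (h r (hu r r.2).le).symm.trans (hη.2 r)⟩

/-! ## Two-state Markov semigroups -/

/-- The integral of `exp (-a s)` over `[0, t]`, equal to `(1 - exp (-a t)) / a` if `a ≠ 0` and to
`t` if `a = 0`. -/
noncomputable def expIntegral (a t : ℝ) : ℝ := ∫ s in (0 : ℝ)..t, Real.exp (-(a * s))

theorem hasDerivAt_expIntegral (a t : ℝ) :
    HasDerivAt (expIntegral a) (Real.exp (-(a * t))) t :=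
  ((show Continuous fun s : ℝ => Real.exp (-(a * s)) by fun_prop).integral_hasStrictDerivAt
    0 t).hasDerivAt

theorem expIntegral_zero_right (a : ℝ) : expIntegral a 0 = 0 :=
  intervalIntegral.integral_same

theorem expIntegral_zero_left (t : ℝ) : expIntegral 0 t = t := by
  simp [expIntegral]

theorem mul_expIntegral (a t : ℝ) : a * expIntegral a t = 1 - Real.exp (-(a * t)) := by
  have hd : ∀ s ∈ uIcc 0 t, HasDerivAt (fun s => -Real.exp (-(a * s)))
      (a * Real.exp (-(a * s))) s := fun s _ => by
    have h : HasDerivAt (fun s => -(a * s)) (-a) s := by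
      simpa using (hasDerivAt_id s).const_mul (-a)
    exact h.exp.neg.congr_deriv (by ring)
  rw [expIntegral, ← intervalIntegral.integral_const_mul,
    intervalIntegral.integral_eq_sub_of_hasDerivAt hd
      (Continuous.intervalIntegrable (by fun_prop) _ _)]
  simp
  ring

/-- This is multiplicativity of `1 - a * expIntegral a t = exp (-(a * t))`, divided by `a`; the case
`a = 0` is plain additivity. -/
theorem expIntegral_add (a s t : ℝ) : expIntegral a (s + t) =
    expIntegral a s + expIntegral a t - a * expIntegral a s * expIntegral a t := by
  rcases eq_or_ne a 0 with rfl | ha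
  · simp [expIntegral_zero_left]
  · refine mul_left_cancel₀ ha ?_
    have h : a * (expIntegral a s + expIntegral a t - a * expIntegral a s * expIntegral a t) =
        1 - (1 - a * expIntegral a s) * (1 - a * expIntegral a t) := by ring
    rw [h]
    simp only [mul_expIntegral, sub_sub_cancel, ← Real.exp_add]
    congr 2
    ring

theorem expIntegral_pos (a : ℝ) {t : ℝ} (ht : 0 < t) : 0 < expIntegral a t :=
  intervalIntegral.intervalIntegral_pos_of_pos (Continuous.intervalIntegrable (by fun_prop) _ _)
    (fun _ => Real.exp_pos _) ht

theorem continuous_expIntegral_left (t : ℝ) : Continuous fun a => expIntegral a t :=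
  intervalIntegral.continuous_parametric_intervalIntegral_of_continuous' (by fun_prop) 0 t

/-- The total rate of a two-state rate matrix. -/
def totalRate (Q : Matrix Bool Bool ℝ) : ℝ := Q true false + Q false true

/-- The transition matrix `exp (t Q)` of a two-state Markov chain with rate matrix `Q`. -/
noncomputable def twoStateTrans (Q : Matrix Bool Bool ℝ) (t : ℝ) : Matrix Bool Bool ℝ :=
  1 + expIntegral (totalRate Q) t • Q

namespace IsRateMatrix

variable {Q : Matrix Bool Bool ℝ} (hQ : IsRateMatrix Q)

include hQ

theorem apply_true_true : Q true true = -Q true false := by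
  have := hQ.2 true
  rw [Fintype.sum_bool] at this
  linarith

theorem apply_false_false : Q false false = -Q false true := by
  have := hQ.2 false
  rw [Fintype.sum_bool] at this
  linarith

/-- A two-state rate matrix has rank at most one and trace `-totalRate Q`. Hence the exponential
series collapses to the identity plus a multiple of `Q`. -/
theorem mul_self_eq : Q * Q = (-totalRate Q) • Q := by
  ext x y
  cases x <;> cases y <;>
    simp only [Matrix.mul_apply, Fintype.sum_bool, Matrix.smul_apply, smul_eq_mul, totalRate,
      hQ.apply_true_true, hQ.apply_false_false] <;> ring

theorem sum_twoStateTrans (t : ℝ) (x : Bool) : ∑ y, twoStateTrans Q t x y = 1 := by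
  simp [twoStateTrans, Matrix.one_apply, -Fintype.univ_bool,
    Finset.sum_add_distrib, ← Finset.mul_sum, hQ.2 x]

theorem twoStateTrans_add (s t : ℝ) :
    twoStateTrans Q (s + t) = twoStateTrans Q s * twoStateTrans Q t := by
  simp only [twoStateTrans, expIntegral_add, add_mul, mul_add, one_mul, mul_one, smul_mul_assoc,
    mul_smul_comm, hQ.mul_self_eq]
  module

/-- For the diagonal: the two off-diagonal entries are positive and add up to `1 - exp (-(totalRate
Q * t)) < 1`, so each of them is below 1. -/
theorem twoStateTrans_pos (hpos : ∀ x y, x ≠ y → 0 < Q x y) {t : ℝ} (ht : 0 < t) (x y : Bool) :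
    0 < twoStateTrans Q t x y := by
  have h1 := hpos true false (by simp)
  have h2 := hpos false true (by simp)
  have hg := expIntegral_pos (totalRate Q) ht
  have h3 := mul_expIntegral (totalRate Q) t
  have h4 := Real.exp_pos (-(totalRate Q * t))
  have h5 := mul_pos hg h1
  have h6 := mul_pos hg h2
  have h7 : totalRate Q * expIntegral (totalRate Q) t =
    expIntegral (totalRate Q) t * Q true false + expIntegral (totalRate Q) t * Q false true := by
    rw [totalRate]; ring
  cases x <;> cases y <;> simp [twoStateTrans, hQ.apply_true_true, hQ.apply_false_false, h5, h6]
    <;> linarith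

end IsRateMatrix

/-- The rate matrix of the two-state chain with unit rates, scaled by `ε` and added to `Q`. -/
def perturbRate (Q : Matrix Bool Bool ℝ) (ε : ℝ) : Matrix Bool Bool ℝ :=
  Matrix.of fun x y => Q x y + ε * if x = y then -1 else 1

theorem isRateMatrix_perturbRate {Q : Matrix Bool Bool ℝ} (hQ : IsRateMatrix Q) {ε : ℝ}
    (hε : 0 < ε) : IsRateMatrix (perturbRate Q ε) ∧ ∀ x y, x ≠ y → 0 < perturbRate Q ε x y := by
  have h : ∀ x y, x ≠ y → 0 < perturbRate Q ε x y := fun x y hxy => by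
    have := hQ.1 x y hxy
    simp only [perturbRate, Matrix.of_apply, if_neg hxy]
    linarith
  refine ⟨⟨fun x y hxy => (h x y hxy).le, fun x => ?_⟩, h⟩
  cases x <;> simp [perturbRate, hQ.apply_true_true, hQ.apply_false_false] <;> ring

theorem tendsto_twoStateTrans_perturbRate (Q : Matrix Bool Bool ℝ) (t : ℝ) (x y : Bool) :
    Tendsto (fun ε => twoStateTrans (perturbRate Q ε) t x y) (𝓝 0)
      (𝓝 (twoStateTrans Q t x y)) := by
  have hc : Continuous fun ε => twoStateTrans (perturbRate Q ε) t x y := by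
    simp only [twoStateTrans, Matrix.add_apply, Matrix.smul_apply, smul_eq_mul, totalRate,
      perturbRate, Matrix.of_apply]
    exact continuous_const.add (((continuous_expIntegral_left t).comp (by fun_prop)).mul
      (by fun_prop))
  convert hc.tendsto 0
  ext x y
  simp [perturbRate]

/-- The difference quotients of the semigroup converge to the rate matrix. -/
theorem tendsto_twoStateTrans_quotient (Q : Matrix Bool Bool ℝ) :
    Tendsto (fun Δ : ℝ≥0 => (Δ : ℝ)⁻¹ • (twoStateTrans Q Δ - 1)) (𝓝[>] 0) (𝓝 Q) := by
  have h := (hasDerivAt_expIntegral (totalRate Q) 0).tendsto_slope_zero_right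
  simp only [zero_add, expIntegral_zero_right, sub_zero, mul_zero, neg_zero, Real.exp_zero,
    smul_eq_mul] at h
  have hcoe : Tendsto (fun Δ : ℝ≥0 => (Δ : ℝ)) (𝓝[>] 0) (𝓝[>] 0) :=
    tendsto_nhdsWithin_iff.mpr ⟨(NNReal.continuous_coe.tendsto 0).mono_left inf_le_left,
      eventually_mem_nhdsWithin.mono fun Δ hΔ => NNReal.coe_pos.mpr hΔ⟩
  simpa [twoStateTrans, smul_smul] using (h.comp hcoe).smul_const Q

/-- For every initial distribution there is a process with dynamics in `𝒬`. -/
theorem exists_mem_ictmc {𝒬 : Set (Matrix Bool Bool ℝ)} (h𝒬 : IsRateSet 𝒬)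
    {𝓜 : Set (Bool → ℝ)} {p : Bool → ℝ} (hp : p ∈ stdSimplex ℝ Bool) (hp𝓜 : p ∈ 𝓜) :
    ∃ P ∈ ictmc 𝒬 𝓜, P.initial = p := by
  obtain ⟨Q, hQ𝒬⟩ := h𝒬.nonempty
  have hQ := h𝒬.isRateMatrix Q hQ𝒬
  let ε : ℕ → ℝ := fun n => 1 / ((n : ℝ) + 1)
  have hε : ∀ n, 0 < ε n := fun n => Nat.one_div_pos_of_nat
  have hε0 : Tendsto ε atTop (𝓝 0) := tendsto_one_div_add_atTop_nhds_zero_nat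
  have hR := fun n => isRateMatrix_perturbRate hQ (hε n)
  -- Adding `ε n` to both initial masses makes them positive with sum `1 + 2 * ε n`, hence the
  -- normalisation.
  obtain ⟨P, hP0, hP⟩ := exists_markov_process
    (p := fun n x => (p x + ε n) / (1 + 2 * ε n))
    (T := fun n (t : ℝ≥0) => twoStateTrans (perturbRate Q (ε n)) t)
    (p₀ := p) (T₀ := fun t : ℝ≥0 => twoStateTrans Q t)
    (fun n x => div_pos (add_pos_of_nonneg_of_pos (hp.1 x) (hε n)) (by linarith [hε n]))
    (fun n => by
      have h1 : p true + p false = 1 := by simpa using hp.2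
      have h2 : 1 + 2 * ε n ≠ 0 := by linarith [hε n]
      rw [Fintype.sum_bool, ← add_div, div_eq_one_iff_eq h2]
      linarith)
    (fun n t ht => (hR n).1.twoStateTrans_pos (hR n).2 (NNReal.coe_pos.mpr ht))
    (fun n t => (hR n).1.sum_twoStateTrans t)
    (fun n s t => by rw [NNReal.coe_add, (hR n).1.twoStateTrans_add])
    (fun x => by
      have h1 : Tendsto (fun n => (p x + ε n) / (1 + 2 * ε n)) atTop
          (𝓝 ((p x + 0) / (1 + 2 * 0))) :=
        (hε0.const_add _).div ((hε0.const_mul 2).const_add 1) (by norm_num)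
      simpa using h1)
    (fun t x y => (tendsto_twoStateTrans_perturbRate Q t x y).comp hε0)
  have hright : ∀ (t : ℝ≥0) (u : Finset ℝ≥0) (xu : ↥u → Bool), (∀ s ∈ u, s < t) →
      Tendsto (fun Δ => P.rightQuotient u xu t Δ) (𝓝[>] 0) (𝓝 Q) := fun t u xu hu => by
    refine (tendsto_twoStateTrans_quotient Q).congr' ?_
    filter_upwards [self_mem_nhdsWithin] with Δ hΔ
    rw [StochasticProcess.rightQuotient, hP u xu t _ hu (lt_add_of_pos_right t hΔ),
      add_tsub_cancel_left]
  have hleft : ∀ (t : ℝ≥0) (u : Finset ℝ≥0) (xu : ↥u → Bool), (∀ s ∈ u, s < t) → 0 < t →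
      Tendsto (fun Δ => P.leftQuotient u xu t Δ) (𝓝[>] 0) (𝓝 Q) := fun t u xu hu ht => by
    refine (tendsto_twoStateTrans_quotient Q).congr' ?_
    -- The left quotient starts at `t - Δ`, which must still lie after the whole history; for the
    -- finitely many `s ∈ u` this holds once `Δ` is small.
    have hu' : ∀ᶠ Δ in 𝓝[>] (0 : ℝ≥0), ∀ s ∈ u, Δ < t - s :=
      (Finset.eventually_all u).mpr fun s hs =>
        nhdsWithin_le_nhds (eventually_lt_nhds (tsub_pos_of_lt (hu s hs)))
    filter_upwards [self_mem_nhdsWithin, hu', nhdsWithin_le_nhds (eventually_lt_nhds ht)]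
      with Δ hΔ hΔu hΔt
    rw [StochasticProcess.leftQuotient, hP u xu _ t (fun s hs => lt_tsub_comm.mp (hΔu s hs))
      (tsub_lt_self ht hΔ), tsub_tsub_cancel_of_le hΔt.le]
  have hbound : ∀ (G : ℝ≥0 → Matrix Bool Bool ℝ), Tendsto G (𝓝[>] 0) (𝓝 Q) → ∀ x y,
      ∃ c : ℝ, ∀ᶠ Δ in 𝓝[>] (0 : ℝ≥0), |G Δ x y| ≤ c := fun G hG x y =>
    ⟨|Q x y| + 1, (((tendsto_pi_nhds.mp (tendsto_pi_nhds.mp hG x) y).abs).eventually_lt_const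
      (lt_add_one _)).mono fun _ h => h.le⟩
  refine ⟨P, ⟨fun t u xu hu x y => ⟨hbound _ (hright t u xu hu) x y,
    fun ht => hbound _ (hleft t u xu hu ht) x y⟩, hP0 ▸ hp𝓜, ?_⟩, hP0⟩
  rintro t u xu hu R ⟨Δ, hΔ, hΔ0, h⟩
  -- The full one-sided limits exist and equal `Q`, so every limit point along a sequence is `Q`.
  have hΔ' : Tendsto Δ atTop (𝓝[>] 0) :=
    tendsto_nhdsWithin_iff.mpr ⟨hΔ0, Eventually.of_forall hΔ⟩
  rcases h with h | ⟨ht, h⟩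
  · rwa [tendsto_nhds_unique h ((hright t u xu hu).comp hΔ')]
  · rwa [tendsto_nhds_unique h ((hleft t u xu hu ht).comp hΔ')]

/-! ## Expectations at time zero -/

/-- The equation `w = {0}` is a hypothesis so that both `exampleTime` and `exampleTime ∪
exampleTime` are covered. -/
theorem sum_fun_unique_time {X : Type*} [Fintype X] {w : Finset ℝ≥0} (hw : w = {0})
    (G : (↥w → X) → ℝ) : ∑ z : ↥w → X, G z = ∑ x : X, G fun _ => x := by
  subst hw
  exact ((Equiv.funUnique ↥({0} : Finset ℝ≥0) X).symm.sum_comp G).symm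

namespace StochasticProcess

variable {X : Type*} (P : StochasticProcess X) {w : Finset ℝ≥0}

theorem prob_time_zero (hw : w = {0}) (x : X) : P.prob w (fun _ => x) = P.initial x := by
  subst hw
  simp [prob, initial, stateEvent]

theorem expect_time_zero [Fintype X] (hw : w = {0}) (g : (↥w → X) → ℝ) :
    P.expect w g = ∑ x, (g fun _ => x) * P.initial x := by
  simp only [expect, sum_fun_unique_time hw, P.prob_time_zero hw]

end StochasticProcess

theorem exampleTime_eq : exampleTime = {0} := rfl

theorem exampleTime_union : exampleTime ∪ exampleTime = {0} := Finset.union_self _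

theorem joint_example {X Y : Type*} (out : OutputModel X Y) (S : Set Y) (x : X) :
    out.joint (u := exampleTime) (fun _ => S) (fun _ => x) = out.prob x S := by
  rw [OutputModel.joint, Finset.prod_const, Finset.card_univ, Fintype.card_coe, exampleTime_eq,
    Finset.card_singleton, pow_one]

/-- The updated expectation in the example, for a time-zero observation with event `S`. -/
theorem condExpect_example {Y : Type*} (P : AugmentedProcess Bool Y) (S : Set Y) :
    P.outputProb exampleTime (fun _ => S) =
        P.output.prob true S * P.state.initial true +
          P.output.prob false S * P.state.initial false ∧
      P.condExpect exampleTime exampleTime (fun _ => S) exampleFun =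
        (P.output.prob true S * P.state.initial true -
          P.output.prob false S * P.state.initial false) /
        (P.output.prob true S * P.state.initial true +
          P.output.prob false S * P.state.initial false) := by
  have hout : P.outputProb exampleTime (fun _ => S) =
      P.output.prob true S * P.state.initial true +
        P.output.prob false S * P.state.initial false := by
    rw [AugmentedProcess.outputProb, sum_fun_unique_time exampleTime_eq, Fintype.sum_bool]
    simp only [joint_example, P.state.prob_time_zero exampleTime_eq]
  have hres : ∀ b c : Bool, ((restrictRight (u := exampleTime) (v := exampleTime) fun _ => b) =
      fun _ => c) ↔ b = c := fun b c =>
    ⟨fun h => congrFun h ⟨0, Finset.mem_singleton_self 0⟩, fun h => by rw [h]; rfl⟩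
  have hj : ∀ b : Bool, P.jointProb exampleTime exampleTime (fun _ => S) (fun _ => b) =
      P.output.prob b S * P.state.initial b := fun b => by
    rw [AugmentedProcess.jointProb, sum_fun_unique_time exampleTime_union, Fintype.sum_bool]
    simp only [hres, P.state.prob_time_zero exampleTime_union]
    cases b <;> simp [← joint_example] <;> exact Or.inl rfl
  refine ⟨hout, ?_⟩
  rw [AugmentedProcess.condExpect, sum_fun_unique_time exampleTime_eq, Fintype.sum_bool, hj, hj, hout]
  simp only [exampleFun, if_true, Bool.false_eq_true, if_false]
  ring

/-! ## The output model of the example -/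

theorem isOpen_exampleInterval (d : ℝ) : IsOpen (exampleInterval d) :=
  isOpen_lt (by fun_prop) continuous_const

theorem lebesgueIcc_exampleInterval_pos {d : ℝ} (hd : 0 < d) :
    0 < lebesgueIcc.real (exampleInterval d) := by
  refine ENNReal.toReal_pos (ne_of_gt ?_) (measure_ne_top _ _)
  rw [lebesgueIcc, (MeasurableEmbedding.subtype_coe measurableSet_Icc).comap_apply]
  have hsub : Ioo 0 (min d 1) ⊆ Subtype.val '' exampleInterval d := fun y hy => by
    have h1 := hy.2.trans_le (min_le_left _ _)
    have h2 := hy.2.trans_le (min_le_right _ _)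
    exact ⟨⟨y, by linarith [hy.1], h2.le⟩, by
      simpa [exampleInterval, abs_of_pos hy.1] using h1, rfl⟩
  refine lt_of_lt_of_le ?_ (measure_mono hsub)
  rw [Real.volume_Ioo, sub_zero]
  exact ENNReal.ofReal_pos.mpr (lt_min hd one_pos)

theorem exampleOutput_prob_true (S : Set (Icc (-1 : ℝ) 1)) :
    exampleOutput.prob true S = lebesgueIcc.real S / 2 := by
  simp [exampleOutput, exampleDensity]
  ring

/-- The density `|y|` is below `d` on the interval. So the ratio to the Lebesgue measure is at most
`d`, which makes the limit density zero in the state `false`. -/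
theorem exampleOutput_prob_false_le (d : ℝ) :
    exampleOutput.prob false (exampleInterval d) ≤ d * lebesgueIcc.real (exampleInterval d) := by
  have h := setIntegral_mono_on (s := exampleInterval d) (μ := lebesgueIcc)
    (exampleDensity_integrable false).integrableOn (integrable_const d).integrableOn
    (isOpen_exampleInterval d).measurableSet fun y hy => by
      simpa [exampleDensity] using le_of_lt hy
  rw [setIntegral_const, smul_eq_mul, mul_comm] at h
  exact h

theorem exampleOutput_prob_false_nonneg (d : ℝ) :
    0 ≤ exampleOutput.prob false (exampleInterval d) :=
  exampleOutput.prob_nonneg _ _ (isOpen_exampleInterval d).measurableSet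

/-- The density vanishes only at the point 0, a null set, whereas the interval has positive measure.
-/
theorem exampleOutput_prob_false_pos {d : ℝ} (hd : 0 < d) :
    0 < exampleOutput.prob false (exampleInterval d) := by
  have hm := (isOpen_exampleInterval d).measurableSet
  refine lt_of_le_of_ne (exampleOutput_prob_false_nonneg d) fun h => ?_
  have h0 := (setIntegral_eq_zero_iff_of_nonneg_ae
    (Eventually.of_forall (exampleDensity_nonneg false))
    (exampleDensity_integrable false).integrableOn).mp h.symm
  have h1 : lebesgueIcc (exampleInterval d \ {⟨0, by norm_num, by norm_num⟩}) = 0 := by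
    rw [Filter.EventuallyEq, ae_restrict_iff' hm] at h0
    refine measure_mono_null (fun y hy => ?_) h0
    intro hy'
    have := hy' hy.1
    simp only [exampleDensity, Bool.false_eq_true, if_false, Pi.zero_apply, abs_eq_zero] at this
    exact hy.2 (Subtype.ext this)
  have h2 : lebesgueIcc {(⟨0, by norm_num, by norm_num⟩ : Icc (-1 : ℝ) 1)} = 0 := by
    rw [lebesgueIcc, (MeasurableEmbedding.subtype_coe measurableSet_Icc).comap_apply]
    simp
  have h3 : lebesgueIcc (exampleInterval d) = 0 :=
    le_antisymm ((measure_le_inter_add_sdiff _ _ _).trans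
      (by rw [h1, measure_mono_null inter_subset_right h2, add_zero])) bot_le
  exact (lebesgueIcc_exampleInterval_pos hd).ne' (by simp [Measure.real, h3])

theorem shrinksTo_exampleInterval {δ : ℕ → ℝ} (hδ : ∀ i, 0 < δ i) (hanti : Antitone δ)
    (hlim : Tendsto δ atTop (𝓝 0)) :
    ShrinksTo exampleOutput (fun i (_ : ↥exampleTime) => exampleInterval (δ i)) examplePoint := by
  refine ⟨fun i _ => (isOpen_exampleInterval _).measurableSet,
    fun i => pi_mono fun _ _ y hy => lt_of_lt_of_le hy (hanti i.le_succ), ?_⟩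
  ext z
  simp only [mem_iInter, mem_univ_pi, mem_singleton_iff]
  constructor
  · intro h
    funext t
    have : |((z t : Icc (-1 : ℝ) 1) : ℝ)| ≤ 0 := ge_of_tendsto' hlim fun i => (h i t).le
    exact Subtype.ext (abs_nonpos_iff.mp this)
  · rintro rfl i t
    simpa [exampleInterval, examplePoint] using hδ i

/-- The limit density of the example: `1 / 2` in the state `true` and `0` in the state `false`. -/
noncomputable def exampleLimit (x : ↥exampleTime → Bool) : ℝ :=
  if x ⟨0, Finset.mem_singleton_self 0⟩ then 1 / 2 else 0

theorem isLimitDensity_exampleLimit {δ : ℕ → ℝ} (hδ : ∀ i, 0 < δ i)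
    (hlim : Tendsto δ atTop (𝓝 0)) :
    IsLimitDensity exampleOutput (fun i (_ : ↥exampleTime) => exampleInterval (δ i))
      (fun i => lebesgueIcc.real (exampleInterval (δ i))) exampleLimit := by
  have hpos := fun i => lebesgueIcc_exampleInterval_pos (hδ i)
  refine ⟨hpos, fun x => ?_⟩
  have hx : x = fun _ => x ⟨0, Finset.mem_singleton_self 0⟩ := by
    funext t
    exact congrArg x (Subtype.ext (Finset.mem_singleton.mp (exampleTime_eq ▸ t.2)))
  generalize x ⟨0, Finset.mem_singleton_self 0⟩ = b at hx
  subst hx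
  simp only [joint_example, exampleLimit]
  cases b
  · simp only [Bool.false_eq_true, if_false]
    refine squeeze_zero (fun i => div_nonneg (exampleOutput_prob_false_nonneg _) (hpos i).le)
      (fun i => ?_) hlim
    rw [div_le_iff₀ (hpos i)]
    exact exampleOutput_prob_false_le _
  · refine tendsto_const_nhds.congr fun i => ?_
    have := (hpos i).ne'
    rw [exampleOutput_prob_true, if_pos rfl]
    field_simp

/-! ## The limit-based update and the generalised Bayes' rule -/

section Example

variable {𝒬 : Set (Matrix Bool Bool ℝ)} {δ : ℕ → ℝ}

theorem exists_mem_ictmc_initial_single (h𝒬 : IsRateSet 𝒬) (b : Bool) :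
    ∃ P ∈ ictmc 𝒬 (stdSimplex ℝ Bool), P.initial = Pi.single b 1 :=
  exists_mem_ictmc h𝒬 (single_mem_stdSimplex ℝ b) (single_mem_stdSimplex ℝ b)

theorem upperExp_exampleLimit_pos (h𝒬 : IsRateSet 𝒬) :
    0 < upperExp 𝒬 (stdSimplex ℝ Bool) exampleTime exampleLimit := by
  have hval : ∀ P : StochasticProcess Bool,
      P.expect exampleTime exampleLimit = P.initial true / 2 := fun P => by
    rw [P.expect_time_zero exampleTime_eq, Fintype.sum_bool]
    simp [exampleLimit]
    ring
  obtain ⟨P, hP, hP0⟩ := exists_mem_ictmc_initial_single h𝒬 true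
  -- The real `sSup` is only meaningful for bounded sets; the point mass on `true` attains the bound
  -- `1 / 2`.
  have hbdd : BddAbove ((fun P : StochasticProcess Bool => P.expect exampleTime exampleLimit) ''
      ictmc 𝒬 (stdSimplex ℝ Bool)) := by
    refine ⟨1 / 2, ?_⟩
    rintro _ ⟨P, hP, rfl⟩
    have h1 : P.initial true + P.initial false = 1 := by simpa using hP.2.1.2
    simp only [hval]
    linarith [hP.2.1.1 false]
  refine lt_of_lt_of_le ?_ (le_csSup hbdd ⟨P, hP, rfl⟩)
  simp [hval, hP0]

/-- At `m = 1` the expectation is zero for every process; for `m > 1` it is negative under the point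
mass on `true`. -/
theorem isGreatest_bayesRuleSet_example (h𝒬 : IsRateSet 𝒬) :
    IsGreatest (bayesRuleSet 𝒬 (stdSimplex ℝ Bool) exampleTime exampleTime exampleLimit
      exampleFun) 1 := by
  have hval : ∀ (P : StochasticProcess Bool) (m : ℝ), P.expect (exampleTime ∪ exampleTime)
      (fun z => exampleLimit (restrictLeft z) * (exampleFun (restrictRight z) - m)) =
        (1 - m) / 2 * P.initial true := fun P m => by
    rw [P.expect_time_zero exampleTime_union, Fintype.sum_bool]
    simp only [exampleLimit, exampleFun, restrictLeft, restrictRight, if_true, Bool.false_eq_true,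
      if_false]
    ring
  obtain ⟨P, hP, hP0⟩ := exists_mem_ictmc_initial_single h𝒬 true
  constructor
  · rw [bayesRuleSet, mem_ofPred_eq, lowerExp]
    refine le_csInf ⟨_, mem_image_of_mem _ hP⟩ ?_
    rintro _ ⟨P, hP, rfl⟩
    simp [hval]
  · intro m hm
    by_contra! hlt
    have hbdd : BddBelow ((fun P : StochasticProcess Bool => P.expect (exampleTime ∪ exampleTime)
        (fun z => exampleLimit (restrictLeft z) * (exampleFun (restrictRight z) - m))) ''
        ictmc 𝒬 (stdSimplex ℝ Bool)) := by
      refine ⟨(1 - m) / 2, ?_⟩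
      rintro _ ⟨P, hP, rfl⟩
      have h1 : P.initial true + P.initial false = 1 := by simpa using hP.2.1.2
      simp only [hval]
      nlinarith [hP.2.1.1 false]
    have := le_trans hm (csInf_le hbdd ⟨P, hP, rfl⟩)
    simp only [hval, hP0, Pi.single_eq_same] at this
    linarith

/-- The process starts in `false` surely. Every observation event has positive probability and
leaves the state at `false`, so the updated expectations are constantly `-1`. -/
theorem exists_hasPointExpect_neg_one (h𝒬 : IsRateSet 𝒬) (hδ : ∀ i, 0 < δ i) :
    ∃ P ∈ icthmc 𝒬 (stdSimplex ℝ Bool) exampleOutput,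
      P.HasPointExpect exampleTime exampleTime (fun i _ => exampleInterval (δ i)) exampleFun
        (-1) := by
  obtain ⟨P, hP, hP0⟩ := exists_mem_ictmc_initial_single h𝒬 false
  have hpos := fun i => exampleOutput_prob_false_pos (hδ i)
  refine ⟨_, ⟨P, hP, rfl⟩, fun i => ?_, tendsto_const_nhds.congr fun i => ?_⟩
  · rw [(condExpect_example _ _).1]
    simpa [hP0] using hpos i
  · rw [(condExpect_example _ _).2]
    simp [hP0, neg_div, div_self (hpos i).ne']

/-- Each updated expectation is `(a - b) / (a + b)` with `a ≥ 0` and `a + b > 0`. -/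
theorem neg_one_le_of_hasPointExpect {P : AugmentedProcess Bool (Icc (-1 : ℝ) 1)}
    (hP : P ∈ icthmc 𝒬 (stdSimplex ℝ Bool) exampleOutput) {a : ℝ}
    (ha : P.HasPointExpect exampleTime exampleTime (fun i _ => exampleInterval (δ i)) exampleFun
      a) : -1 ≤ a := by
  obtain ⟨P, hP, rfl⟩ := hP
  refine ge_of_tendsto' ha.2 fun i => ?_
  have hpos := ha.1 i
  rw [(condExpect_example _ _).1] at hpos
  rw [(condExpect_example _ _).2, le_div_iff₀ hpos]
  have h1 : 0 ≤ exampleOutput.prob true (exampleInterval (δ i)) :=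
    exampleOutput.prob_nonneg _ _ (isOpen_exampleInterval _).measurableSet
  have := mul_nonneg h1 (hP.2.1.1 true)
  dsimp only
  linarith

theorem limitLowerExp_example (h𝒬 : IsRateSet 𝒬) (hδ : ∀ i, 0 < δ i) :
    limitLowerExp (icthmc 𝒬 (stdSimplex ℝ Bool) exampleOutput) exampleTime exampleTime
      (fun i _ => exampleInterval (δ i)) exampleFun = -1 := by
  have h : IsLeast {a : ℝ | ∃ P ∈ icthmc 𝒬 (stdSimplex ℝ Bool) exampleOutput,
      P.HasPointExpect exampleTime exampleTime (fun i _ => exampleInterval (δ i)) exampleFun a}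
      (-1) :=
    ⟨exists_hasPointExpect_neg_one h𝒬 hδ, fun _ ⟨_, hP, ha⟩ => neg_one_le_of_hasPointExpect hP ha⟩
  exact h.csInf_eq

end Example

/-! ### Assembly of the two claims -/

theorem isRateSet_singleton_zero {X : Type*} [Fintype X] :
    IsRateSet ({0} : Set (Matrix X X ℝ)) where
  isRateMatrix := by
    rintro _ rfl
    exact ⟨fun _ _ _ => le_rfl, fun _ => Finset.sum_const_zero⟩
  nonempty := singleton_nonempty 0
  bounded := ⟨1, by rintro _ rfl x; simp⟩
  convex := convex_singleton 0
  separate_rows R hR := by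
    ext x y
    simp [mem_singleton_iff.mp (hR x)]

theorem mainTheorem10 :
    -- existence of an ICTHMC for which the limit-based update violates the generalised Bayes' rule
    (∃ (X Y : Type) (_ : Fintype X) (_ : DecidableEq X)
      (𝒬 : Set (Matrix X X ℝ)) (𝓜 : Set (X → ℝ)) (out : OutputModel X Y)
      (u v : Finset ℝ≥0) (f : (↥v → X) → ℝ) (y : ↥u → Y) (O : ℕ → ↥u → Set Y)
      (lam : ℕ → ℝ) (φ : (↥u → X) → ℝ) (m : ℝ),
      IsRateSet 𝒬 ∧ 𝓜.Nonempty ∧ 𝓜 ⊆ stdSimplex ℝ X ∧ u.Nonempty ∧ v.Nonempty ∧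
      ShrinksTo out O y ∧ IsLimitDensity out O lam φ ∧ 0 < upperExp 𝒬 𝓜 u φ ∧
      (updatable (icthmc 𝒬 𝓜 out) u v O f).Nonempty ∧
      IsGreatest (bayesRuleSet 𝒬 𝓜 u v φ f) m ∧
      limitLowerExp (icthmc 𝒬 𝓜 out) u v O f ≠ m) ∧
    -- the values in the example
    (∀ (𝒬 : Set (Matrix Bool Bool ℝ)) (δ : ℕ → ℝ),
      IsRateSet 𝒬 → (∀ i, 0 < δ i) → Antitone δ → Tendsto δ atTop (𝓝 0) →
      ShrinksTo exampleOutput (fun i (_ : ↥exampleTime) => exampleInterval (δ i)) examplePoint ∧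
      ∃ φ : (↥exampleTime → Bool) → ℝ,
        IsLimitDensity exampleOutput (fun i (_ : ↥exampleTime) => exampleInterval (δ i))
          (fun i => lebesgueIcc.real (exampleInterval (δ i))) φ ∧
        0 < upperExp 𝒬 (stdSimplex ℝ Bool) exampleTime φ ∧
        (updatable (icthmc 𝒬 (stdSimplex ℝ Bool) exampleOutput) exampleTime exampleTime
          (fun i _ => exampleInterval (δ i)) exampleFun).Nonempty ∧
        limitLowerExp (icthmc 𝒬 (stdSimplex ℝ Bool) exampleOutput) exampleTime exampleTime
          (fun i _ => exampleInterval (δ i)) exampleFun = -1 ∧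
        IsGreatest (bayesRuleSet 𝒬 (stdSimplex ℝ Bool) exampleTime exampleTime φ exampleFun) 1) := by
  have hexample : ∀ (𝒬 : Set (Matrix Bool Bool ℝ)) (δ : ℕ → ℝ),
      IsRateSet 𝒬 → (∀ i, 0 < δ i) →
      (updatable (icthmc 𝒬 (stdSimplex ℝ Bool) exampleOutput) exampleTime exampleTime
        (fun i _ => exampleInterval (δ i)) exampleFun).Nonempty := fun 𝒬 δ h𝒬 hδ => by
    obtain ⟨P, hP, h⟩ := exists_hasPointExpect_neg_one h𝒬 hδ
    exact ⟨P, hP, -1, h⟩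
  refine ⟨?_, fun 𝒬 δ h𝒬 hδ hanti hlim => ⟨shrinksTo_exampleInterval hδ hanti hlim, exampleLimit,
    isLimitDensity_exampleLimit hδ hlim, upperExp_exampleLimit_pos h𝒬, hexample 𝒬 δ h𝒬 hδ,
    limitLowerExp_example h𝒬 hδ, isGreatest_bayesRuleSet_example h𝒬⟩⟩
  -- The existence claim is the example with the zero rate matrix as only dynamics and `δ i = 1 / (i
  -- + 1)`.
  have h𝒬 : IsRateSet ({0} : Set (Matrix Bool Bool ℝ)) := isRateSet_singleton_zero
  have hδ : ∀ i : ℕ, (0 : ℝ) < 1 / ((i : ℝ) + 1) := fun i => Nat.one_div_pos_of_nat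
  have hanti : Antitone fun i : ℕ => 1 / ((i : ℝ) + 1) := fun i j h =>
    Nat.one_div_le_one_div h
  have hlim : Tendsto (fun i : ℕ => 1 / ((i : ℝ) + 1)) atTop (𝓝 0) :=
    tendsto_one_div_add_atTop_nhds_zero_nat
  refine ⟨Bool, Icc (-1 : ℝ) 1, inferInstance, inferInstance, {0}, stdSimplex ℝ Bool,
    exampleOutput, exampleTime, exampleTime, exampleFun, examplePoint,
    fun i _ => exampleInterval (1 / ((i : ℝ) + 1)),
    fun i => lebesgueIcc.real (exampleInterval (1 / ((i : ℝ) + 1))), exampleLimit, 1, h𝒬,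
    ⟨_, single_mem_stdSimplex ℝ true⟩, Subset.rfl, Finset.singleton_nonempty 0,
    Finset.singleton_nonempty 0, shrinksTo_exampleInterval hδ hanti hlim,
    isLimitDensity_exampleLimit hδ hlim, upperExp_exampleLimit_pos h𝒬, hexample _ _ h𝒬 hδ,
    isGreatest_bayesRuleSet_example h𝒬, ?_⟩
  rw [limitLowerExp_example h𝒬 hδ]
  norm_num
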